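/- **Setting.** Let $\mathcal N$ be a finite set of buses, $\mathcal E\subseteq\mathcal N\times\mathcal N$ a set of transmission lines with $(i,j)\in\mathcal E\Rightarrow(j,i)\notin\mathcal E$, and $\tilde{\mathcal E}\subseteq\mathcal N\times\mathcal N$ a set of communication links; both graphs, with directions forgotten, are connected. Each bus $j$ carries a finite set $\mathcal L_j$ of on-off loads; $\tilde{\mathcal L}=\{(l,j):l\in\mathcal L_j,\ j\in\mathcal N\}$. Let $B_{ij},M_j,A_j,\gamma_j,\kappa_j,\tau_j,\tau_{ij},\overline d_{l,j}>0$, $p^L_j, c_{l,j}\in\mathbb R$, $\rho_{l,j}\in\{0,1\}$. For $\sigma\in\{0,1\}^{\tilde{\mathcal L}}$ the system $\dot x=f_\sigma(x)$ with state $x=(\eta,\omega,p^M,p^c,\psi)$ is $$\dot\eta_{ij}=\omega_i-\omega_j,\quad (i,j)\in\mathcal E,$$ $$M_j\dot\omega_j=p^M_j-p^L_j-A_j\omega_j-\sum_{l\in\mathcal L_j}\overline d_{l,j}\sigma_{l,j}-\sum_{k:(j,k)\in\mathcal E}B_{jk}\eta_{jk}+\sum_{i:(i,j)\in\mathcal E}B_{ij}\eta_{ij},$$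 $$\gamma_j\dot p^M_j=-(p^M_j+\kappa_j\omega_j-\kappa_jp^c_j),$$ $$\tau_{ij}\dot\psi_{ij}=p^c_i-p^c_j,\quad (i,j)\in\tilde{\mathcal E},$$ $$\tau_j\dot p^c_j=-p^M_j+p^L_j+\sum_{l\in\mathcal L_j}\overline d_{l,j}\sigma_{l,j}-\sum_{k:(j,k)\in\tilde{\mathcal E}}\psi_{jk}+\sum_{i:(i,j)\in\tilde{\mathcal E}}\psi_{ij}.$$ An equilibrium is a pair $(x^*,\sigma^*)$ with $f_{\sigma^*}(x^*)=0$. **Switching algorithm.** Let $K=\sum_j\kappa_j$, $\ell=\sum_jp^L_j$, $\beta=\max\overline d_{l,j}$ ($0$ if there are no loads), $\delta>0$, $\bar\beta=\beta+\delta/2$, and $\bar c=c+r$, where $r\in(0,\delta/2)^{\tilde{\mathcal L}}$ has no duplicate entries, and $\mu\in(0,1)$. Start with $p^c_{min}(0)=\ell/K$, $p^c_{max}(0)=(\ell+\sum\overline d_{l,j})/K$, $\phi(0)=0$, $k=0$. While $\phi(k)=0$, increase $k$ by one and set (in each case distinction the first case that applies is taken) $$p^c_{set}(k)=\mu p^c_{max}(k-1)+(1-\mu)p^c_{min}(k-1),$$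 $$\hat\sigma_{l,j}(k)=0\text{ if }p^c_{set}(k)>\bar c_{l,j}/\overline d_{l,j},\quad 1\text{ if }p^c_{set}(k)<-\bar c_{l,j}/\overline d_{l,j},\quad\rho_{l,j}\text{ otherwise},$$ $$\hat p^c(k)=\tfrac1K\big(\ell+\sum\overline d_{l,j}\hat\sigma_{l,j}(k)\big),$$ $$p^c_{min}(k)=p^c_{set}(k)\text{ if }p^c_{set}(k)<\hat p^c(k)-\bar\beta/K,\quad p^c_{min}(k-1)\text{ otherwise},$$ $$p^c_{max}(k)=p^c_{set}(k)\text{ if }p^c_{set}(k)>\hat p^c(k),\quad p^c_{max}(k-1)\text{ otherwise},$$ $$\phi(k)=1\text{ if }p^c_{max}(k)-p^c_{min}(k)=p^c_{max}(k-1)-p^c_{min}(k-1),\quad 0\text{ otherwise},$$ and output $\overline\sigma_{l,j}(k)=\hat\sigma_{l,j}(k)$ if $\phi(k)=1$; if $\phi(k)=0$, output $\overline\sigma_{l,j}(k)=1$ if $p^c_{max}(k)<-\bar c_{l,j}/\overline d_{l,j}-\bar\beta/K$, $0$ if $p^c_{min}(k)>\bar c_{l,j}/\overline d_{l,j}+\bar\beta/K$,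 and $\rho_{l,j}$ otherwise. **Solutions.** Let $0\le t_1\le t_2\le\cdots$ be the times at which the iterations $k=1,2,\dots$ of the algorithm are completed, with $t_{\hat k+1}=\infty$ if the algorithm stops at iteration $\hat k$. A (complete) solution is a pair $(x,\sigma)$ of functions on $[0,\infty)$ such that at every time $t\geq 0$ the switching state is given by $\sigma(t)=\sigma(0)$ for $t\in[0,t_1)$ and $\sigma(t)=\overline\sigma(k)$ for $t\in[t_k,t_{k+1})$ with $k$ a performed iteration (in particular these intervals cover $[0,\infty)$), $x$ is absolutely continuous on every $[0,T]$, and $\dot x(t)=f_{\sigma(t)}(x(t))$ for almost all $t\ge0$. **Theorem.** Every equilibrium $(x^*,\sigma^*)$ satisfies $\omega^*=0$ and $p^{c,*}\in\operatorname{Im}(\mathbf 1)$, i.e. all $p^{c,*}_j$ are equal. Every solution, from any initial condition, converges to the set of equilibria: there is $\sigma^*\in\{0,1\}^{\tilde{\mathcal L}}$ such that $\sigma(t)=\sigma^*$ for all sufficiently large $t$, the set $\{x^*:f_{\sigma^*}(x^*)=0\}$ is non-empty, and the distance of $x(t)$ to this set tends to $0$ as $t\to\infty$. -/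

import Mathlib

open Filter Topology MeasureTheory

noncomputable section

/-- The set of all on-off loads of the network: pairs of a bus `j` and a load `l` at the bus `j`. -/
abbrev Load {N : Type*} (L : N → Type*) : Type _ := (j : N) × L j

/-- The numerical value `0` or `1` of a switching state. -/
def onOff (b : Bool) : ℝ := if b then 1 else 0

/-- The data of a power network with on-off loads: `N` is the set of buses and `L j` the set of
on-off loads at the bus `j`. -/
structure PowerNetwork (N : Type*) [Fintype N] (L : N → Type*) [∀ j, Fintype (L j)] where
  /-- transmission lines, with an arbitrary orientation -/
  lines : Finset (N × N)
  lines_oriented : ∀ i j, (i, j) ∈ lines → (j, i) ∉ lines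
  lines_connected : (SimpleGraph.fromRel fun i j => (i, j) ∈ lines).Connected
  /-- communication links, each with an orientation -/
  links : Finset (N × N)
  links_connected : (SimpleGraph.fromRel fun i j => (i, j) ∈ links).Connected
  /-- line susceptances -/
  B : lines → ℝ
  B_pos : ∀ e, 0 < B e
  /-- generator inertias -/
  M : N → ℝ
  M_pos : ∀ j, 0 < M j
  /-- frequency-independent uncontrollable demand -/
  pL : N → ℝ
  /-- damping coefficients -/
  A : N → ℝ
  A_pos : ∀ j, 0 < A j
  /-- generation time constants -/
  γ : N → ℝ
  γ_pos : ∀ j, 0 < γ j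
  /-- droop coefficients -/
  κ : N → ℝ
  κ_pos : ∀ j, 0 < κ j
  /-- time constants of the power command variables at the buses -/
  τ : N → ℝ
  τ_pos : ∀ j, 0 < τ j
  /-- time constants of the power command integrators at the communication links -/
  τlink : links → ℝ
  τlink_pos : ∀ e, 0 < τlink e
  /-- magnitudes of the on-off loads -/
  d : Load L → ℝ
  d_pos : ∀ i, 0 < d i
  /-- desired switching states of the on-off loads -/
  ρ : Load L → Bool
  /-- costs of deviating from the desired switching states -/
  c : Load L → ℝ
  /-- margin of the load-switching algorithm -/
  δ : ℝ
  δ_pos : 0 < δ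
  /-- cost perturbations -/
  r : Load L → ℝ
  r_mem : ∀ i, r i ∈ Set.Ioo 0 (δ / 2)
  r_injective : Function.Injective r
  /-- interpolation parameter of the load-switching algorithm -/
  μ : ℝ
  μ_mem : μ ∈ Set.Ioo (0 : ℝ) 1

namespace PowerNetwork

variable {N : Type*} [Fintype N] {L : N → Type*} [∀ j, Fintype (L j)]

/-! ### The continuous dynamics for a given switching state -/

/-- The continuous state `x = (η, ω, p^M, p^c, ψ)`. -/
abbrev State (P : PowerNetwork N L) : Type _ :=
  (P.lines → ℝ) × (N → ℝ) × (N → ℝ) × (N → ℝ) × (P.links → ℝ)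

section

variable (P : PowerNetwork N L)

/-- Power angle differences across the lines. -/
def η (x : P.State) : P.lines → ℝ := x.1

/-- Frequency deviations. -/
def ω (x : P.State) : N → ℝ := x.2.1

/-- Mechanical power injections. -/
def pM (x : P.State) : N → ℝ := x.2.2.1

/-- Power commands. -/
def pc (x : P.State) : N → ℝ := x.2.2.2.1

/-- Integrated power command differences across the communication links. -/
def ψ (x : P.State) : P.links → ℝ := x.2.2.2.2

/-- Total on-off demand at the bus `j`. -/
def demand (σ : Load L → Bool) (j : N) : ℝ := ∑ l : L j, P.d ⟨j, l⟩ * onOff (σ ⟨j, l⟩)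

variable [DecidableEq N]

/-- Power flowing out of the bus `j`, along lines `(j, k)`, minus power flowing into it, along lines
`(i, j)`; the line `e` carries the power `B e * η e`. -/
def netOutflow (x : P.State) (j : N) : ℝ :=
  (∑ e : P.lines, if e.1.1 = j then P.B e * P.η x e else 0)
    - ∑ e : P.lines, if e.1.2 = j then P.B e * P.η x e else 0

/-- Sum of `ψ` over the links `(j, k)` minus the sum of `ψ` over the links `(i, j)`. -/
def netCommand (x : P.State) (j : N) : ℝ :=
  (∑ e : P.links, if e.1.1 = j then P.ψ x e else 0)
    - ∑ e : P.links, if e.1.2 = j then P.ψ x e else 0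

/-- The vector field `f_σ`: swing equations, first-order generation with droop, and primal-dual
power command dynamics, for the switching state `σ`. -/
def vectorField (σ : Load L → Bool) (x : P.State) : P.State :=
  (fun e => P.ω x e.1.1 - P.ω x e.1.2,
   fun j => (P.pM x j - P.pL j - P.A j * P.ω x j - P.demand σ j - P.netOutflow x j) / P.M j,
   fun j => -(P.pM x j + P.κ j * P.ω x j - P.κ j * P.pc x j) / P.γ j,
   fun j => (-P.pM x j + P.pL j + P.demand σ j - P.netCommand x j) / P.τ j,
   fun e => (P.pc x e.1.1 - P.pc x e.1.2) / P.τlink e)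

/-- The set of equilibria `(x, σ)`. -/
def equilibria : Set (P.State × (Load L → Bool)) := {z | P.vectorField z.2 z.1 = 0}

end

/-! ### The load-switching algorithm -/

section

variable (P : PowerNetwork N L)

/-- Aggregate droop. -/
def K : ℝ := ∑ j, P.κ j

/-- Aggregate uncontrollable demand. -/
def ell : ℝ := ∑ j, P.pL j

/-- Magnitude of the largest on-off load (`0` if there is no load). -/
def β : ℝ := ⨆ i, P.d i

/-- The perturbed margin `β + δ / 2`. -/
def βbar : ℝ := P.β + P.δ / 2

/-- Perturbed costs. -/
def cbar (i : Load L) : ℝ := P.c i + P.r i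

/-- The variables of the algorithm after an iteration. -/
structure AlgState (L : N → Type*) where
  pmin : ℝ
  pmax : ℝ
  pset : ℝ
  phat : ℝ
  σhat : Load L → Bool
  φ : Bool

/-- The initialization of the algorithm. -/
def algInit : AlgState L where
  pmin := P.ell / P.K
  pmax := (P.ell + ∑ i, P.d i) / P.K
  pset := 0
  phat := 0
  σhat := P.ρ
  φ := false

/-- The switching states selected at the power command level `p`. -/
def select (p : ℝ) (i : Load L) : Bool :=
  if p > P.cbar i / P.d i then false
  else if p < -(P.cbar i / P.d i) then true
  else P.ρ i

/-- The power command level that balances generation and demand for the switching states `σ`. -/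
def balance (σ : Load L → Bool) : ℝ := (P.ell + ∑ i, P.d i * onOff (σ i)) / P.K

/-- One iteration of the algorithm. -/
def algStep (s : AlgState L) : AlgState L :=
  let pset := P.μ * s.pmax + (1 - P.μ) * s.pmin
  let σhat := P.select pset
  let phat := P.balance σhat
  let pmin := if pset < phat - P.βbar / P.K then pset else s.pmin
  let pmax := if pset > phat then pset else s.pmax
  { pmin := pmin
    pmax := pmax
    pset := pset
    phat := phat
    σhat := σhat
    φ := decide (pmax - pmin = s.pmax - s.pmin) }

/-- The variables of the algorithm after `k` iterations. They are meaningful as long as the loop has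
not been left before the iteration `k`, see `Performed`. -/
def alg : ℕ → AlgState L
  | 0 => P.algInit
  | k + 1 => P.algStep (alg k)

/-- The loop performs the iteration `k ≥ 1`: it has not stopped earlier. -/
def Performed (k : ℕ) : Prop := 1 ≤ k ∧ ∀ m < k, (P.alg m).φ = false

/-- The output of the iteration `k` of the algorithm. -/
def σbar (k : ℕ) (i : Load L) : Bool :=
  if (P.alg k).φ = true then (P.alg k).σhat i
  else if (P.alg k).pmax < -(P.cbar i / P.d i) - P.βbar / P.K then true
  else if (P.alg k).pmin > P.cbar i / P.d i + P.βbar / P.K then false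
  else P.ρ i

/-! ### Solutions of the switched closed-loop system -/

/-- Completion times `t k`, `k ≥ 1`, of the iterations of the algorithm. -/
def IsIterationTimes (t : ℕ → ℝ) : Prop := 0 ≤ t 1 ∧ ∀ k, 1 ≤ k → t k ≤ t (k + 1)

/-- The switching state follows the algorithm at all times `s ≥ 0`: it keeps its initial value on
`[0, t 1)` and equals the output of the iteration `k` on `[t k, t (k + 1))`, where `t (k + 1) = ∞` if
the algorithm stops at the iteration `k`. -/
def IsSwitchingSignal (t : ℕ → ℝ) (σ : ℝ → Load L → Bool) : Prop :=
  ∀ s, 0 ≤ s →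
    (s < t 1 ∧ σ s = σ 0) ∨
    ∃ k, P.Performed k ∧ t k ≤ s ∧ (s < t (k + 1) ∨ (P.alg k).φ = true) ∧ σ s = P.σbar k

/-- `(x, σ)` is a complete Caratheodory solution, on `[0, ∞)`, of the switched closed-loop system
with completion times `t`. -/
structure IsSolution [DecidableEq N] (t : ℕ → ℝ) (x : ℝ → P.State) (σ : ℝ → Load L → Bool) :
    Prop where
  switching : P.IsSwitchingSignal t σ
  absolutelyContinuous : ∀ T, 0 < T → AbsolutelyContinuousOnInterval x 0 T
  deriv : ∀ᵐ s : ℝ, 0 ≤ s → HasDerivAt x (P.vectorField (σ s) (x s)) s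

end

end PowerNetwork

end

/-! The switching stops, and what remains is a dissipative linear system. Along the algorithm the
lower end `pmin` never decreases and the upper end `pmax` never increases, because the trial level
is a convex combination of the two. The threshold tests that decide an output therefore change truth
value at most once per load. So the output freezes, whether the loop stops or runs forever
(`IsSwitchingSignal.exists_eventually_eq`).

For a frozen switching state the field is affine, and it has a zero because balanced supplies are
divergences of flows on connected graphs (`exists_equilibrium`). Relative to that zero the dynamics
are linear. The quadratic `energy` decreases at twice the rate `dissipation`, which sees only
frequency and mechanical power (`energy_balance`). Energy sublevel sets are bounded, so a Barbalat
argument makes these two components vanish. Applied again to derivatives, it carries the decay to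
the power command and then to the whole velocity (`tendsto_linearField`).

No limit of the flow variables is needed: in finite dimension the distance to the kernel of a linear
map is bounded by a multiple of the size of the image (`exists_infDist_ker_le`), and the translated
kernel is the set of equilibria. -/

noncomputable section

/-! ### Calculus on a half-line -/

/-- An absolutely continuous function which solves an autonomous differential equation with
continuous right-hand side almost everywhere is a classical solution. -/
theorem hasDerivAt_of_absolutelyContinuous_of_ae {E : Type*} [NormedAddCommGroup E]
    [NormedSpace ℝ E] [CompleteSpace E] {x : ℝ → E} {F : E → E} (hF : Continuous F) {T : ℝ}
    (hT : 0 < T) (hac : ∀ R, 0 < R → AbsolutelyContinuousOnInterval x 0 R)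
    (hd : ∀ᵐ s : ℝ, T ≤ s → HasDerivAt x (F (x s)) s) :
    ∀ s, T < s → HasDerivAt x (F (x s)) s := by
  -- Clamping time at `T` gives an integrand continuous on the whole line. As `T > 0`, the clamped
  -- time is interior to an interval where `x` is absolutely continuous.
  have hcont : Continuous fun u => x (max u T) := by
    refine continuous_iff_continuousAt.2 fun u => ?_
    have hR : 0 < max u T + 1 := by linarith [le_max_right u T]
    have h1 : ContinuousOn x (Set.Icc 0 (max u T + 1)) := by
      simpa [Set.uIcc_of_le hR.le] using (hac _ hR).continuousOn
    have h2 : ContinuousAt x (max u T) :=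
      h1.continuousAt (Icc_mem_nhds (by linarith [le_max_right u T]) (by linarith))
    exact ContinuousAt.comp (f := fun u => max u T) h2
      (continuous_id.max continuous_const).continuousAt
  have hh : Continuous fun u => F (x (max u T)) := hF.comp hcont
  set G : ℝ → E := fun s => ∫ u in T..s, F (x (max u T)) with hG
  have hGd : ∀ s, HasDerivAt G (F (x (max s T))) s := fun s =>
    intervalIntegral.integral_hasDerivAt_right (hh.intervalIntegrable _ _)
      hh.stronglyMeasurable.stronglyMeasurableAtFilter hh.continuousAt
  have hGc : ContDiff ℝ 1 G := by
    rw [contDiff_one_iff_deriv]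
    refine ⟨fun s => (hGd s).differentiableAt, ?_⟩
    have : deriv G = fun s => F (x (max s T)) := funext fun s => (hGd s).deriv
    rw [this]; exact hh
  -- The difference `x - G` is absolutely continuous with derivative zero almost everywhere, hence
  -- constant.
  have key : ∀ s, T ≤ s → x s = x T + G s := by
    intro s hs
    have hac' : AbsolutelyContinuousOnInterval (x - G) T s := by
      refine AbsolutelyContinuousOnInterval.sub ((hac s (by linarith)).mono ?_)
        hGc.contDiffOn.absolutelyContinuousOnInterval
      rw [Set.uIcc_of_le hs, Set.uIcc_of_le (by linarith)]
      exact Set.Icc_subset_Icc_left hT.le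
    obtain ⟨C, hC⟩ := hac'.const_of_ae_hasDerivAt_zero (by
      filter_upwards [hd] with u hu hmem
      rw [Set.uIcc_of_le hs] at hmem
      have := (hu hmem.1).sub (hGd u)
      rwa [max_eq_left hmem.1, sub_self] at this)
    have h1 := hC T Set.left_mem_uIcc
    have h2 := hC s Set.right_mem_uIcc
    simp only [Pi.sub_apply] at h1 h2
    have h3 : G T = 0 := by simp [hG]
    rw [h3, sub_zero] at h1
    rw [h1, ← h2]; abel
  intro s hs
  have h := (hGd s).const_add (x T)
  rw [max_eq_left hs.le] at h
  refine h.congr_of_eventuallyEq ?_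
  filter_upwards [lt_mem_nhds hs] with u hu using key u hu.le

/-- If `g` converges at infinity and its second derivative is bounded, then its first derivative
tends to zero. -/
theorem tendsto_deriv_zero_of_tendsto {g g₁ g₂ : ℝ → ℝ} {T C l : ℝ}
    (h₁ : ∀ t, T < t → HasDerivAt g (g₁ t) t) (h₂ : ∀ t, T < t → HasDerivAt g₁ (g₂ t) t)
    (hC : ∀ t, T < t → |g₂ t| ≤ C) (hg : Tendsto g atTop (𝓝 l)) :
    Tendsto g₁ atTop (𝓝 0) := by
  have hC0 : 0 ≤ C := (abs_nonneg _).trans (hC (T + 1) (by linarith))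
  -- Two mean value inequalities: one for `g₁`, then one for `g` minus its linear part at `t`.
  have landau : ∀ t, T < t → ∀ h, 0 < h → |g₁ t| * h ≤ |g (t + h) - g t| + C * h * h := by
    intro t ht h hh
    have hlip : ∀ u ∈ Set.Icc t (t + h), |g₁ u - g₁ t| ≤ C * h := by
      intro u hu
      have := norm_image_sub_le_of_norm_deriv_le_segment' (f := g₁) (f' := g₂) (a := t)
        (b := t + h) (C := C) (fun v hv => (h₂ v (ht.trans_le hv.1)).hasDerivWithinAt)
        (fun v hv => hC v (ht.trans_le hv.1)) u hu
      refine this.trans (mul_le_mul_of_nonneg_left (by linarith [hu.2]) hC0)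
    have := norm_image_sub_le_of_norm_deriv_le_segment' (f := fun u => g u - g₁ t * u)
        (f' := fun u => g₁ u - g₁ t) (a := t) (b := t + h) (C := C * h)
        (fun v hv => by
          have := (h₁ v (ht.trans_le hv.1)).sub ((hasDerivAt_id v).const_mul (g₁ t))
          rw [mul_one] at this
          exact this.hasDerivWithinAt)
        (fun v hv => hlip v ⟨hv.1, hv.2.le⟩) (t + h) ⟨by linarith, le_rfl⟩
    rw [Real.norm_eq_abs] at this
    rw [← abs_of_pos hh, ← abs_mul, abs_of_pos hh]
    have e : g₁ t * h = (g (t + h) - g t) - (g (t + h) - g₁ t * (t + h) - (g t - g₁ t * t)) := by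
      ring
    rw [e]
    refine (abs_sub _ _).trans ?_
    have e2 : t + h - t = h := by ring
    rw [e2] at this
    linarith
  rw [Metric.tendsto_atTop]
  intro ε hε
  -- This makes `C * h < ε / 2`; adding 1 covers `C = 0`. The increment of `g` over the fixed length
  -- `h` then tends to zero.
  set h : ℝ := ε / (2 * (C + 1)) with hh
  have hpos : 0 < h := by positivity
  have hlim : Tendsto (fun t => |g (t + h) - g t|) atTop (𝓝 0) := by
    have := ((hg.comp (tendsto_atTop_add_const_right atTop h tendsto_id)).sub hg).abs
    simpa using this
  obtain ⟨t₀, ht₀⟩ := eventually_atTop.1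
    (hlim.eventually (gt_mem_nhds (show 0 < ε / 2 * h by positivity)))
  refine ⟨max t₀ (T + 1), fun t ht => ?_⟩
  have h3 := landau t (by linarith [(le_max_right t₀ (T + 1)).trans ht]) h hpos
  have h4 := ht₀ t ((le_max_left _ _).trans ht)
  have h5 : C * h < ε / 2 := by
    rw [hh, mul_div_assoc', div_lt_div_iff₀ (by positivity) (by positivity)]
    nlinarith
  rw [Real.dist_eq, sub_zero]
  refine lt_of_mul_lt_mul_right (a := h) ?_ hpos.le
  nlinarith

/-- Barbalat's lemma along a bounded trajectory of an autonomous differential equation. -/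
theorem tendsto_deriv_zero_along_trajectory {E : Type*} [NormedAddCommGroup E] [ProperSpace E]
    {y : ℝ → E} {g g₁ g₂ : E → ℝ} {T l : ℝ} {S : Set E} (hS : Bornology.IsBounded S)
    (hy : ∀ t, T < t → y t ∈ S)
    (h₁ : ∀ t, T < t → HasDerivAt (fun s => g (y s)) (g₁ (y t)) t)
    (h₂ : ∀ t, T < t → HasDerivAt (fun s => g₁ (y s)) (g₂ (y t)) t)
    (hg₂ : Continuous g₂) (hg : Tendsto (fun t => g (y t)) atTop (𝓝 l)) :
    Tendsto (fun t => g₁ (y t)) atTop (𝓝 0) := by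
  obtain ⟨C, hC⟩ := hS.isCompact_closure.exists_bound_of_continuousOn hg₂.continuousOn
  exact tendsto_deriv_zero_of_tendsto h₁ h₂ (fun t ht => hC _ (subset_closure (hy t ht))) hg

/-- The distance to the kernel of a linear map is controlled by the size of the image. -/
theorem exists_infDist_ker_le {E F : Type*} [NormedAddCommGroup E] [NormedSpace ℝ E]
    [FiniteDimensional ℝ E] [NormedAddCommGroup F] [NormedSpace ℝ F] [FiniteDimensional ℝ F]
    (f : E →L[ℝ] F) : ∃ C : ℝ, ∀ y, ∃ z, f z = 0 ∧ ‖y - z‖ ≤ C * ‖f y‖ := by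
  obtain ⟨q, hq⟩ := (LinearMap.range f.toLinearMap).exists_isCompl
  -- A linear right inverse on the range is automatically bounded. Subtracting the lift of `f y`
  -- from `y` lands in the kernel.
  obtain ⟨r, hr⟩ := f.toLinearMap.rangeRestrict.exists_rightInverse_of_surjective
    (LinearMap.range_rangeRestrict _)
  set G := LinearMap.toContinuousLinearMap r
  have hG : ∀ w : LinearMap.range f.toLinearMap, f (G w) = w := fun w =>
    congrArg Subtype.val (LinearMap.congr_fun hr w)
  refine ⟨‖G‖, fun y => ⟨y - G ⟨f y, y, rfl⟩, ?_, ?_⟩⟩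
  · rw [map_sub, hG, sub_self]
  · rw [sub_sub_cancel]
    exact G.le_opNorm ⟨f y, y, rfl⟩

/-! ### Weighted sums of squares -/

/-- The weighted sum of squares of the entries of a vector. -/
def weightedSq {ι : Type*} [Fintype ι] (w f : ι → ℝ) : ℝ := ∑ i, w i * f i ^ 2

section

variable {ι : Type*} [Fintype ι] {w : ι → ℝ}

theorem weightedSq_nonneg (hw : ∀ i, 0 < w i) (f : ι → ℝ) : 0 ≤ weightedSq w f :=
  Finset.sum_nonneg fun i _ => mul_nonneg (hw i).le (sq_nonneg _)

theorem mul_sq_le_weightedSq (hw : ∀ i, 0 < w i) (f : ι → ℝ) (i : ι) :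
    w i * f i ^ 2 ≤ weightedSq w f :=
  Finset.single_le_sum (f := fun i => w i * f i ^ 2)
    (fun i _ => mul_nonneg (hw i).le (sq_nonneg _)) (Finset.mem_univ i)

theorem isBounded_weightedSq_le (hw : ∀ i, 0 < w i) (C : ℝ) :
    Bornology.IsBounded {f | weightedSq w f ≤ C} := by
  rw [← Bornology.forall_isBounded_image_eval_iff]
  intro i
  refine (Metric.isBounded_closedBall (x := (0 : ℝ)) (r := √(C / w i))).subset ?_
  rintro _ ⟨f, hf, rfl⟩
  rw [mem_closedBall_zero_iff]
  refine Real.abs_le_sqrt ((le_div_iff₀' (hw i)).2 ((mul_sq_le_weightedSq hw f i).trans hf))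

theorem HasDerivAt.weightedSq {f : ℝ → ι → ℝ} {f' : ι → ℝ} {t : ℝ} (hf : HasDerivAt f f' t) :
    HasDerivAt (fun s => _root_.weightedSq w (f s)) (2 * ∑ i, w i * (f t i * f' i)) t := by
  have h := HasDerivAt.fun_sum (u := Finset.univ) fun i _ =>
    (((hasDerivAt_pi.1 hf i).fun_pow 2).const_mul (w i))
  refine h.congr_deriv ?_
  rw [Finset.mul_sum]
  exact Finset.sum_congr rfl fun i _ => by push_cast; ring

theorem tendsto_apply_of_tendsto_weightedSq (hw : ∀ i, 0 < w i) {α : Type*} {m : Filter α}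
    {f : α → ι → ℝ} (h : Tendsto (fun a => weightedSq w (f a)) m (𝓝 0)) (i : ι) :
    Tendsto (fun a => f a i) m (𝓝 0) := by
  have h1 : Tendsto (fun a => w i * f a i ^ 2) m (𝓝 0) :=
    squeeze_zero (fun a => mul_nonneg (hw i).le (sq_nonneg _))
      (fun a => mul_sq_le_weightedSq hw (f a) i) h
  have h2 : Tendsto (fun a => f a i ^ 2) m (𝓝 0) := by
    have := h1.const_mul (w i)⁻¹
    simpa [(hw i).ne'] using this
  have h3 := h2.sqrt
  simp only [Real.sqrt_sq_eq_abs, Real.sqrt_zero] at h3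
  exact (tendsto_zero_iff_abs_tendsto_zero _).2 h3

end

/-! ### Flows on finite directed graphs -/

/-- An equivalence relation that contains the edges of a connected graph is total. -/
theorem SimpleGraph.Connected.rel_of_fromRel {V : Type*} {r s : V → V → Prop}
    (h : (SimpleGraph.fromRel r).Connected) (hs : Equivalence s) (hrs : ∀ i j, r i j → s i j)
    (i j : V) : s i j := by
  obtain ⟨p⟩ := h.preconnected i j
  induction p with
  | nil => exact hs.refl _
  | cons hadj _ ih =>
    rw [SimpleGraph.fromRel_adj] at hadj
    exact hs.trans (hadj.2.elim (hrs _ _) fun h => hs.symm (hrs _ _ h)) ih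

/-- The divergence of a flow on a directed graph: outflow minus inflow at each vertex. -/
def divergence {V : Type*} [DecidableEq V] (S : Finset (V × V)) : (S → ℝ) →ₗ[ℝ] (V → ℝ) where
  toFun f j := (∑ e : S, if e.1.1 = j then f e else 0) - ∑ e : S, if e.1.2 = j then f e else 0
  map_add' f g := by
    funext j
    simp only [Pi.add_apply, ← Finset.sum_filter, Finset.sum_add_distrib]
    ring
  map_smul' a f := by
    funext j
    simp only [Pi.smul_apply, ← Finset.sum_filter, smul_eq_mul, RingHom.id_apply,
      ← Finset.mul_sum]
    ring

section

variable {V : Type*} [DecidableEq V] {S : Finset (V × V)}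

theorem divergence_apply (f : S → ℝ) (j : V) : divergence S f j =
    (∑ e : S, if e.1.1 = j then f e else 0) - ∑ e : S, if e.1.2 = j then f e else 0 := rfl

variable [Fintype V]

/-- Summation by parts: each edge contributes only at its two ends. This is the duality that cancels
the network terms in the energy balance. -/
theorem sum_mul_divergence (u : V → ℝ) (f : S → ℝ) :
    ∑ j, u j * divergence S f j = ∑ e : S, (u e.1.1 - u e.1.2) * f e := by
  simp only [divergence_apply, mul_sub, Finset.sum_sub_distrib, Finset.mul_sum, sub_mul]
  congr 1 <;>
  · rw [Finset.sum_comm]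
    simp

theorem sum_divergence (f : S → ℝ) : ∑ j, divergence S f j = 0 := by
  simpa using sum_mul_divergence (fun _ => 1) f

/-- On a connected graph every balanced supply is the divergence of a flow. -/
theorem exists_divergence_eq (h : (SimpleGraph.fromRel fun i j => (i, j) ∈ S).Connected)
    {b : V → ℝ} (hb : ∑ j, b j = 0) : ∃ f, divergence S f = b := by
  -- Shipping one unit from `i` to `j` is possible along an edge, and feasibility is an equivalence
  -- relation since the range is a subspace.
  have hrel : ∀ i j, (Pi.single i 1 - Pi.single j 1 : V → ℝ) ∈ LinearMap.range (divergence S) := by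
    refine h.rel_of_fromRel ⟨fun i => by simp, fun {i j} hij => ?_, fun {i j k} hij hjk => ?_⟩ ?_
    · simpa using Submodule.neg_mem _ hij
    · simpa using Submodule.add_mem _ hij hjk
    · intro i j hij
      refine ⟨Pi.single ⟨(i, j), hij⟩ 1, ?_⟩
      funext k
      simp only [divergence_apply, Pi.sub_apply, Pi.single_apply]
      congr 1 <;> rw [Finset.sum_eq_single ⟨(i, j), hij⟩] <;> simp +contextual [eq_comm]
  obtain ⟨v⟩ := h.nonempty
  -- Everything is shipped to `v`; the terms at `v` cancel because the supplies sum to zero.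
  have : b = ∑ j, b j • (Pi.single j 1 - Pi.single v 1 : V → ℝ) := by
    funext k
    simp [Finset.sum_apply, mul_sub, Finset.sum_sub_distrib, hb,
      Pi.single_apply]
  have hmem : b ∈ LinearMap.range (divergence S) := by
    rw [this]
    exact Submodule.sum_mem _ fun j _ => Submodule.smul_mem _ _ (hrel j v)
  exact hmem

end


namespace PowerNetwork

/-! ### The switching state is eventually constant -/

section

variable {N : Type*} [Fintype N] {L : N → Type*} [∀ j, Fintype (L j)] (P : PowerNetwork N L)

theorem K_pos : 0 < P.K := by
  have := P.lines_connected.nonempty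
  exact Finset.sum_pos (fun j _ => P.κ_pos j) Finset.univ_nonempty

theorem alg_pmin_le_pmax (k : ℕ) : (P.alg k).pmin ≤ (P.alg k).pmax := by
  induction k with
  | zero =>
    simp only [alg, algInit]
    have := P.K_pos
    gcongr
    simpa using Finset.sum_nonneg fun i _ => (P.d_pos i).le
  | succ k ih =>
    simp only [alg, algStep]
    have := P.μ_mem.1
    have := P.μ_mem.2
    split_ifs <;> nlinarith

theorem alg_pmin_le_succ (k : ℕ) : (P.alg k).pmin ≤ (P.alg (k + 1)).pmin := by
  have h := P.alg_pmin_le_pmax k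
  have := P.μ_mem.1
  simp only [alg, algStep]
  split_ifs <;> nlinarith

theorem alg_pmax_succ_le (k : ℕ) : (P.alg (k + 1)).pmax ≤ (P.alg k).pmax := by
  have h := P.alg_pmin_le_pmax k
  have := P.μ_mem.2
  simp only [alg, algStep]
  split_ifs <;> nlinarith

theorem monotone_alg_pmin : Monotone fun k => (P.alg k).pmin :=
  monotone_nat_of_le_succ P.alg_pmin_le_succ

theorem antitone_alg_pmax : Antitone fun k => (P.alg k).pmax :=
  antitone_nat_of_succ_le P.alg_pmax_succ_le

/-- If the algorithm never stops, its output is eventually constant, as the interval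
`[pmin, pmax]` decreases. -/
theorem exists_eventually_σbar_eq (h : ∀ k, (P.alg k).φ = false) :
    ∃ σ', ∀ᶠ k in atTop, P.σbar k = σ' := by
  have hi : ∀ i, ∃ b, ∀ᶠ k in atTop, P.σbar k i = b := by
    intro i
    have h1 : (∀ᶠ k in atTop, (P.alg k).pmax < -(P.cbar i / P.d i) - P.βbar / P.K) ∨
        ∀ᶠ k in atTop, ¬ (P.alg k).pmax < -(P.cbar i / P.d i) - P.βbar / P.K := by
      by_cases hex : ∃ m, (P.alg m).pmax < -(P.cbar i / P.d i) - P.βbar / P.K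
      · obtain ⟨m, hm⟩ := hex
        exact .inl ((eventually_ge_atTop m).mono fun k hk => (P.antitone_alg_pmax hk).trans_lt hm)
      · exact .inr (.of_forall (not_exists.1 hex))
    have h2 : (∀ᶠ k in atTop, (P.alg k).pmin > P.cbar i / P.d i + P.βbar / P.K) ∨
        ∀ᶠ k in atTop, ¬ (P.alg k).pmin > P.cbar i / P.d i + P.βbar / P.K := by
      by_cases hex : ∃ m, (P.alg m).pmin > P.cbar i / P.d i + P.βbar / P.K
      · obtain ⟨m, hm⟩ := hex
        exact .inl ((eventually_ge_atTop m).mono fun k hk =>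
          lt_of_lt_of_le hm (P.monotone_alg_pmin hk))
      · exact .inr (.of_forall (not_exists.1 hex))
    rcases h1 with h1 | h1
    · exact ⟨true, h1.mono fun k hk => by simp [σbar, h k, hk]⟩
    · rcases h2 with h2 | h2
      · exact ⟨false, (h1.and h2).mono fun k hk => by simp only [σbar, h k, hk]; simp⟩
      · exact ⟨P.ρ i, (h1.and h2).mono fun k hk => by simp only [σbar, h k, hk]; simp⟩
  choose σ' hσ' using hi
  exact ⟨σ', (eventually_all.2 hσ').mono fun k hk => funext hk⟩

theorem IsIterationTimes.le {t : ℕ → ℝ} (ht : IsIterationTimes t) {m n : ℕ} (hm : 1 ≤ m)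
    (hmn : m ≤ n) : t m ≤ t n := by
  induction n, hmn using Nat.le_induction with
  | base => exact le_rfl
  | succ n hn ih => exact ih.trans (ht.2 n (hm.trans hn))

/-- A switching signal that follows the algorithm for all times is eventually constant. -/
theorem IsSwitchingSignal.exists_eventually_eq {t : ℕ → ℝ} (ht : IsIterationTimes t)
    {σ : ℝ → Load L → Bool} (hσ : P.IsSwitchingSignal t σ) : ∃ σ', ∀ᶠ s in atTop, σ s = σ' := by
  classical
  by_cases h : ∃ k, (P.alg k).φ = true
  · have hk := Nat.find_spec h
    set k := Nat.find h
    -- The initial flag is `false`. The bound matters because `t` is ordered only from index 1 on.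
    have hk1 : 1 ≤ k := by
      by_contra h0
      rw [show k = 0 by omega] at hk
      simp [alg, algInit] at hk
    refine ⟨P.σbar k, ?_⟩
    filter_upwards [eventually_ge_atTop (t k), eventually_ge_atTop 0] with s hs hs0
    rcases hσ s hs0 with ⟨h1, -⟩ | ⟨m, hm, -, h2, h3⟩
    · linarith [ht.le le_rfl hk1]
    · have hmk : m ≤ k := by
        by_contra hlt
        have := hm.2 k (by omega)
        simp [hk] at this
      rcases hmk.eq_or_lt with rfl | hlt
      · exact h3
      · rcases h2 with h2 | h2
        · linarith [ht.le (Nat.le_add_left 1 m) hlt]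
        · exact absurd h2 (Nat.find_min h hlt)
  · have hφ : ∀ k, (P.alg k).φ = false := fun k => by simpa using not_exists.1 h k
    obtain ⟨σ', hσ'⟩ := P.exists_eventually_σbar_eq hφ
    obtain ⟨m, hm⟩ := eventually_atTop.1 hσ'
    refine ⟨σ', ?_⟩
    -- An iteration `k < m` would have ended by `t (m + 1)`. Since the signal is prescribed at every
    -- time, divergence of the completion times need not be assumed. The index `m + 1` is at least
    -- 1, where `t` is ordered.
    filter_upwards [eventually_ge_atTop (t (m + 1)), eventually_ge_atTop 0] with s hs hs0
    rcases hσ s hs0 with ⟨h1, -⟩ | ⟨k, hk, -, h2, h3⟩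
    · linarith [ht.le le_rfl (Nat.le_add_left 1 m)]
    · rw [h3]
      refine hm k ?_
      by_contra hlt
      rcases h2 with h2 | h2
      · linarith [ht.le (Nat.le_add_left 1 k) (show k + 1 ≤ m + 1 by omega)]
      · simp [hφ k] at h2

end

end PowerNetwork


namespace PowerNetwork

/-! ### The energy of the network -/

section

variable {N : Type*} [Fintype N] {L : N → Type*} [∀ j, Fintype (L j)] (P : PowerNetwork N L)

/-- The energy of the linear part of the dynamics. -/
def energy (y : P.State) : ℝ :=
  weightedSq P.B (P.η y) + weightedSq P.M (P.ω y) +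
    weightedSq (fun j => P.γ j / P.κ j) (P.pM y) + weightedSq P.τ (P.pc y) +
    weightedSq P.τlink (P.ψ y)

/-- The energy dissipated by the dampings and the droops. -/
def dissipation (y : P.State) : ℝ :=
  weightedSq P.A (P.ω y) + weightedSq (fun j => (P.κ j)⁻¹) (P.pM y)

theorem weightedSq_terms_nonneg (y : P.State) :
    0 ≤ weightedSq P.B (P.η y) ∧ 0 ≤ weightedSq P.M (P.ω y) ∧
      0 ≤ weightedSq (fun j => P.γ j / P.κ j) (P.pM y) ∧ 0 ≤ weightedSq P.τ (P.pc y) ∧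
      0 ≤ weightedSq P.τlink (P.ψ y) :=
  ⟨weightedSq_nonneg P.B_pos _, weightedSq_nonneg P.M_pos _,
    weightedSq_nonneg (fun j => div_pos (P.γ_pos j) (P.κ_pos j)) _,
    weightedSq_nonneg P.τ_pos _, weightedSq_nonneg P.τlink_pos _⟩

theorem energy_nonneg (y : P.State) : 0 ≤ P.energy y := by
  obtain ⟨h1, h2, h3, h4, h5⟩ := P.weightedSq_terms_nonneg y
  unfold energy
  positivity

theorem dissipation_nonneg (y : P.State) : 0 ≤ P.dissipation y :=
  add_nonneg (weightedSq_nonneg P.A_pos _)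
    (weightedSq_nonneg (fun j => inv_pos.2 (P.κ_pos j)) _)

theorem isBounded_energy_le (C : ℝ) : Bornology.IsBounded {y | P.energy y ≤ C} := by
  refine Bornology.IsBounded.subset ((isBounded_weightedSq_le P.B_pos C).prod <|
    (isBounded_weightedSq_le P.M_pos C).prod <|
    (isBounded_weightedSq_le (fun j => div_pos (P.γ_pos j) (P.κ_pos j)) C).prod <|
    (isBounded_weightedSq_le P.τ_pos C).prod (isBounded_weightedSq_le P.τlink_pos C)) ?_
  intro y hy
  obtain ⟨h1, h2, h3, h4, h5⟩ := P.weightedSq_terms_nonneg y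
  have hy' : P.energy y ≤ C := hy
  unfold energy at hy'
  refine ⟨?_, ?_, ?_, ?_, ?_⟩
  · change weightedSq P.B (P.η y) ≤ C
    linarith
  · change weightedSq P.M (P.ω y) ≤ C
    linarith
  · change weightedSq (fun j => P.γ j / P.κ j) (P.pM y) ≤ C
    linarith
  · change weightedSq P.τ (P.pc y) ≤ C
    linarith
  · change weightedSq P.τlink (P.ψ y) ≤ C
    linarith

theorem hasDerivAt_coordinates {y : ℝ → P.State} {y' : P.State} {t : ℝ}
    (h : HasDerivAt y y' t) :
    HasDerivAt (fun s => P.η (y s)) (P.η y') t ∧ HasDerivAt (fun s => P.ω (y s)) (P.ω y') t ∧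
      HasDerivAt (fun s => P.pM (y s)) (P.pM y') t ∧
      HasDerivAt (fun s => P.pc (y s)) (P.pc y') t ∧
      HasDerivAt (fun s => P.ψ (y s)) (P.ψ y') t :=
  ⟨h.fst, h.snd.fst, h.snd.snd.fst, h.snd.snd.snd.fst, h.snd.snd.snd.snd⟩

end

/-! ### Equilibria -/

section

variable {N : Type*} [Fintype N] [DecidableEq N] {L : N → Type*} [∀ j, Fintype (L j)]
  (P : PowerNetwork N L)

theorem netOutflow_eq (x : P.State) (j : N) :
    P.netOutflow x j = divergence P.lines (fun e => P.B e * P.η x e) j := rfl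

theorem netCommand_eq (x : P.State) (j : N) :
    P.netCommand x j = divergence P.links (P.ψ x) j := rfl

theorem vectorField_eq_zero_iff (σ : Load L → Bool) (x : P.State) :
    P.vectorField σ x = 0 ↔
      (∀ e : P.lines, P.ω x e.1.1 = P.ω x e.1.2) ∧
      (∀ j, P.pM x j - P.pL j - P.A j * P.ω x j - P.demand σ j - P.netOutflow x j = 0) ∧
      (∀ j, P.pM x j = P.κ j * P.pc x j - P.κ j * P.ω x j) ∧
      (∀ j, -P.pM x j + P.pL j + P.demand σ j - P.netCommand x j = 0) ∧
      ∀ e : P.links, P.pc x e.1.1 = P.pc x e.1.2 := by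
  simp only [vectorField, Prod.ext_iff, funext_iff, Prod.fst_zero, Prod.snd_zero, Pi.zero_apply,
    div_eq_zero_iff, (P.M_pos _).ne', (P.γ_pos _).ne', (P.τ_pos _).ne', (P.τlink_pos _).ne',
    or_false, sub_eq_zero (a := P.ω x _), sub_eq_zero (a := P.pc x _)]
  refine and_congr_right fun _ => and_congr_right fun _ => and_congr_left fun _ =>
    forall_congr' fun j => ?_
  constructor <;> intro h <;> linarith

theorem equilibrium_synchronized {σ : Load L → Bool} {x : P.State}
    (h : P.vectorField σ x = 0) : (∀ j, P.ω x j = 0) ∧ ∃ a, ∀ j, P.pc x j = a := by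
  obtain ⟨hη, hω, -, hpc, hψ⟩ := (P.vectorField_eq_zero_iff σ x).1 h
  have hωeq : ∀ i j, P.ω x i = P.ω x j :=
    P.lines_connected.rel_of_fromRel ⟨fun _ => rfl, Eq.symm, Eq.trans⟩
      fun i j hij => hη ⟨(i, j), hij⟩
  have hpceq : ∀ i j, P.pc x i = P.pc x j :=
    P.links_connected.rel_of_fromRel ⟨fun _ => rfl, Eq.symm, Eq.trans⟩
      fun i j hij => hψ ⟨(i, j), hij⟩
  obtain ⟨v⟩ := P.lines_connected.nonempty
  refine ⟨fun j => ?_, P.pc x v, fun j => hpceq j v⟩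
  have hsum : ∑ i, -(P.A i * P.ω x i) = ∑ i, (P.netOutflow x i + P.netCommand x i) :=
    Finset.sum_congr rfl fun i _ => by linarith [hω i, hpc i]
  simp only [Finset.sum_add_distrib, netOutflow_eq, netCommand_eq, sum_divergence, hωeq _ j,
    Finset.sum_neg_distrib, ← Finset.sum_mul, add_zero, neg_eq_zero, mul_eq_zero] at hsum
  exact hsum.resolve_left (Finset.sum_pos (fun i _ => P.A_pos i) ⟨v, Finset.mem_univ v⟩).ne'

theorem exists_equilibrium (σ : Load L → Bool) : ∃ x, P.vectorField σ x = 0 := by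
  -- The common power command is forced by total balance: with zero frequency deviation, generation
  -- is `κ j * a`.
  set a : ℝ := (∑ j, (P.pL j + P.demand σ j)) / P.K with ha
  have hsum : ∑ j, (P.κ j * a - P.pL j - P.demand σ j) = 0 := by
    have : a * P.K = ∑ j, (P.pL j + P.demand σ j) := div_mul_cancel₀ _ P.K_pos.ne'
    simp only [K, Finset.sum_add_distrib] at this
    simp only [Finset.sum_sub_distrib, ← Finset.sum_mul]
    linarith
  have hsum' : ∑ j, (-(P.κ j * a) + P.pL j + P.demand σ j) = 0 := by
    rw [← neg_eq_zero, ← Finset.sum_neg_distrib, ← hsum]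
    exact Finset.sum_congr rfl fun j _ => by ring
  obtain ⟨f, hf⟩ := exists_divergence_eq P.lines_connected hsum
  obtain ⟨g, hg⟩ := exists_divergence_eq P.links_connected hsum'
  refine ⟨(fun e => f e / P.B e, 0, fun j => P.κ j * a, fun _ => a, g), ?_⟩
  rw [vectorField_eq_zero_iff]
  have hB : (fun e => P.B e * (f e / P.B e)) = f :=
    funext fun e => mul_div_cancel₀ _ (P.B_pos e).ne'
  simp [ω, pM, pc, ψ, η, netOutflow_eq, netCommand_eq, hB, hf, hg]

/-! ### The linear part of the dynamics -/

/-- The linear part of the vector field. -/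
def linearField : P.State →L[ℝ] P.State :=
  LinearMap.toContinuousLinearMap
    { toFun := fun y =>
        (fun e => P.ω y e.1.1 - P.ω y e.1.2,
         fun j => (P.pM y j - P.A j * P.ω y j - P.netOutflow y j) / P.M j,
         fun j => -(P.pM y j + P.κ j * P.ω y j - P.κ j * P.pc y j) / P.γ j,
         fun j => (-P.pM y j - P.netCommand y j) / P.τ j,
         fun e => (P.pc y e.1.1 - P.pc y e.1.2) / P.τlink e)
      map_add' := fun y z => by
        have h : (fun e => P.B e * P.η (y + z) e) =
            (fun e => P.B e * P.η y e) + fun e => P.B e * P.η z e :=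
          funext fun e => mul_add _ _ _
        have h' : P.ψ (y + z) = P.ψ y + P.ψ z := rfl
        simp only [netOutflow_eq, netCommand_eq, h, h', map_add, Prod.mk_add_mk, Pi.add_apply]
        simp only [ω, pM, pc, Prod.fst_add, Prod.snd_add, Pi.add_apply]
        ext <;> simp only [Pi.add_apply] <;> ring
      map_smul' := fun a y => by
        have h : (fun e => P.B e * P.η (a • y) e) = a • fun e => P.B e * P.η y e :=
          funext fun e => mul_left_comm _ _ _
        have h' : P.ψ (a • y) = a • P.ψ y := rfl
        simp only [netOutflow_eq, netCommand_eq, h, h', map_smul, Prod.smul_mk, RingHom.id_apply]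
        simp only [ω, pM, pc, Prod.smul_fst, Prod.smul_snd, Pi.smul_apply, smul_eq_mul]
        ext <;> simp only [Pi.smul_apply, smul_eq_mul] <;> ring }

theorem linearField_apply (y : P.State) : P.linearField y =
    (fun e => P.ω y e.1.1 - P.ω y e.1.2,
     fun j => (P.pM y j - P.A j * P.ω y j - P.netOutflow y j) / P.M j,
     fun j => -(P.pM y j + P.κ j * P.ω y j - P.κ j * P.pc y j) / P.γ j,
     fun j => (-P.pM y j - P.netCommand y j) / P.τ j,
     fun e => (P.pc y e.1.1 - P.pc y e.1.2) / P.τlink e) := rfl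

theorem vectorField_sub (σ : Load L → Bool) (x z : P.State) :
    P.vectorField σ x - P.vectorField σ z = P.linearField (x - z) := by
  rw [map_sub]
  simp only [linearField_apply, vectorField, Prod.mk_sub_mk]
  ext <;> simp only [Pi.sub_apply] <;> ring

theorem continuous_vectorField (σ : Load L → Bool) : Continuous (P.vectorField σ) := by
  have : P.vectorField σ = fun x => P.linearField (x - 0) + P.vectorField σ 0 :=
    funext fun x => by rw [← P.vectorField_sub σ x 0, sub_add_cancel]
  rw [this]
  fun_prop

/-- The couplings between lines and frequencies, and between links and power commands, cancel by
summation by parts. The weights `γ / κ` make the products of `pM` with `ω` and `pc` cancel too,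
leaving only the squares of `ω` and `pM`. -/
theorem energy_balance (y : P.State) :
    2 * ∑ e, P.B e * (P.η y e * P.η (P.linearField y) e) +
      2 * ∑ j, P.M j * (P.ω y j * P.ω (P.linearField y) j) +
      2 * ∑ j, P.γ j / P.κ j * (P.pM y j * P.pM (P.linearField y) j) +
      2 * ∑ j, P.τ j * (P.pc y j * P.pc (P.linearField y) j) +
      2 * ∑ e, P.τlink e * (P.ψ y e * P.ψ (P.linearField y) e) = -2 * P.dissipation y := by
  have h1 : ∑ e, P.B e * (P.η y e * P.η (P.linearField y) e) =
      ∑ j, P.ω y j * P.netOutflow y j := by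
    simp only [netOutflow_eq, sum_mul_divergence]
    refine Finset.sum_congr rfl fun e _ => ?_
    simp only [linearField_apply, η]
    ring
  have h2 : ∑ e, P.τlink e * (P.ψ y e * P.ψ (P.linearField y) e) =
      ∑ j, P.pc y j * P.netCommand y j := by
    simp only [netCommand_eq, sum_mul_divergence]
    refine Finset.sum_congr rfl fun e _ => ?_
    have := (P.τlink_pos e).ne'
    simp only [linearField_apply, ψ]
    field_simp
  rw [h1, h2]
  simp only [dissipation, weightedSq, ← mul_add, Finset.mul_sum, ← Finset.sum_add_distrib]
  refine Finset.sum_congr rfl fun j _ => ?_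
  have hM := (P.M_pos j).ne'
  have hγ := (P.γ_pos j).ne'
  have hκ := (P.κ_pos j).ne'
  have hτ := (P.τ_pos j).ne'
  have e1 : P.ω (P.linearField y) j =
      (P.pM y j - P.A j * P.ω y j - P.netOutflow y j) / P.M j := rfl
  have e2 : P.pM (P.linearField y) j =
      -(P.pM y j + P.κ j * P.ω y j - P.κ j * P.pc y j) / P.γ j := rfl
  have e3 : P.pc (P.linearField y) j = (-P.pM y j - P.netCommand y j) / P.τ j := rfl
  rw [e1, e2, e3]
  field_simp
  ring

/-! ### Trajectories of the linear part -/

theorem hasDerivAt_energy {y : ℝ → P.State} {t : ℝ}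
    (h : HasDerivAt y (P.linearField (y t)) t) :
    HasDerivAt (fun s => P.energy (y s)) (-2 * P.dissipation (y t)) t := by
  obtain ⟨h1, h2, h3, h4, h5⟩ := P.hasDerivAt_coordinates h
  rw [← energy_balance]
  exact (((h1.weightedSq.add h2.weightedSq).add h3.weightedSq).add h4.weightedSq).add
    h5.weightedSq

/-- The derivative of the dissipation along the linear part of the dynamics. -/
def dissipationRate (y : P.State) : ℝ :=
  2 * ∑ j, P.A j * (P.ω y j * P.ω (P.linearField y) j) +
    2 * ∑ j, (P.κ j)⁻¹ * (P.pM y j * P.pM (P.linearField y) j)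

theorem continuous_dissipationRate : Continuous P.dissipationRate := by
  have hω : Continuous P.ω := continuous_fst.comp continuous_snd
  have hpM : Continuous P.pM := continuous_fst.comp (continuous_snd.comp continuous_snd)
  unfold dissipationRate
  fun_prop

theorem hasDerivAt_dissipation {y : ℝ → P.State} {t : ℝ}
    (h : HasDerivAt y (P.linearField (y t)) t) :
    HasDerivAt (fun s => P.dissipation (y s)) (P.dissipationRate (y t)) t := by
  obtain ⟨-, h2, h3, -, -⟩ := P.hasDerivAt_coordinates h
  exact h2.weightedSq.add h3.weightedSq

theorem antitoneOn_energy {y : ℝ → P.State} {T : ℝ}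
    (hy : ∀ t, T < t → HasDerivAt y (P.linearField (y t)) t) :
    AntitoneOn (fun t => P.energy (y t)) (Set.Ioi T) := by
  refine antitoneOn_of_deriv_nonpos (convex_Ioi T)
    (fun t ht => (P.hasDerivAt_energy (hy t ht)).continuousAt.continuousWithinAt)
    (fun t ht => ?_) (fun t ht => ?_) <;> rw [interior_Ioi] at ht
  · exact (P.hasDerivAt_energy (hy t ht)).differentiableAt.differentiableWithinAt
  · rw [(P.hasDerivAt_energy (hy t ht)).deriv]
    linarith [P.dissipation_nonneg (y t)]

theorem exists_tendsto_energy {y : ℝ → P.State} {T : ℝ}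
    (hy : ∀ t, T < t → HasDerivAt y (P.linearField (y t)) t) :
    ∃ l, Tendsto (fun t => P.energy (y t)) atTop (𝓝 l) := by
  -- Clamping at `T + 1` makes the energy monotone on the whole line; the equation is available only
  -- strictly after `T`.
  have hanti : Antitone fun t => P.energy (y (max t (T + 1))) := fun s t hst =>
    P.antitoneOn_energy hy (lt_of_lt_of_le (lt_add_one T) (le_max_right _ _))
      (lt_of_lt_of_le (lt_add_one T) (le_max_right _ _)) (max_le_max_right _ hst)
  refine ⟨_, (tendsto_atTop_ciInf hanti
    ⟨0, by rintro _ ⟨t, rfl⟩; exact P.energy_nonneg _⟩).congr' ?_⟩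
  filter_upwards [eventually_ge_atTop (T + 1)] with t ht
  rw [max_eq_left ht]

/-- Along every trajectory of the linear part, the velocity tends to zero. -/
theorem tendsto_linearField {y : ℝ → P.State} {T : ℝ}
    (hy : ∀ t, T < t → HasDerivAt y (P.linearField (y t)) t) :
    Tendsto (fun t => P.linearField (y t)) atTop (𝓝 0) := by
  set S := {z | P.energy z ≤ P.energy (y (T + 1))}
  have hS : Bornology.IsBounded S := P.isBounded_energy_le _
  have hlt : ∀ t, T + 1 < t → T < t := fun t ht => by linarith
  have hyS : ∀ t, T + 1 < t → y t ∈ S := fun t ht =>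
    P.antitoneOn_energy hy (lt_add_one T) (hlt t ht) ht.le
  obtain ⟨l, hl⟩ := P.exists_tendsto_energy hy
  have hdiss := tendsto_deriv_zero_along_trajectory hS hyS
    (g₁ := fun z => -2 * P.dissipation z) (g₂ := fun z => -2 * P.dissipationRate z)
    (fun t ht => P.hasDerivAt_energy (hy t (hlt t ht)))
    (fun t ht => (P.hasDerivAt_dissipation (hy t (hlt t ht))).const_mul (-2))
    (P.continuous_dissipationRate.const_mul (-2)) hl
  replace hdiss : Tendsto (fun t => P.dissipation (y t)) atTop (𝓝 0) := by
    simpa using hdiss.const_mul (-2)⁻¹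
  -- Decay of a linear observable passes to its derivative: its second derivative is continuous in
  -- the state, hence bounded along the trajectory.
  have hstep : ∀ φ : P.State →L[ℝ] ℝ, Tendsto (fun t => φ (y t)) atTop (𝓝 0) →
      Tendsto (fun t => φ (P.linearField (y t))) atTop (𝓝 0) := fun φ hφ =>
    tendsto_deriv_zero_along_trajectory hS hyS
      (g₁ := fun z => φ (P.linearField z))
      (g₂ := fun z => φ (P.linearField (P.linearField z)))
      (fun t ht => φ.hasFDerivAt.comp_hasDerivAt t (hy t (hlt t ht)))
      (fun t ht => (φ.comp P.linearField).hasFDerivAt.comp_hasDerivAt t (hy t (hlt t ht)))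
      (by fun_prop) hφ
  have hω : ∀ j, Tendsto (fun t => P.ω (y t) j) atTop (𝓝 0) :=
    tendsto_apply_of_tendsto_weightedSq P.A_pos (squeeze_zero
      (fun t => weightedSq_nonneg P.A_pos _)
      (fun t => le_add_of_nonneg_right
        (weightedSq_nonneg (fun j => inv_pos.2 (P.κ_pos j)) _)) hdiss)
  have hpM : ∀ j, Tendsto (fun t => P.pM (y t) j) atTop (𝓝 0) :=
    tendsto_apply_of_tendsto_weightedSq (fun j => inv_pos.2 (P.κ_pos j)) (squeeze_zero
      (fun t => weightedSq_nonneg (fun j => inv_pos.2 (P.κ_pos j)) _)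
      (fun t => le_add_of_nonneg_left (weightedSq_nonneg P.A_pos _)) hdiss)
  let ωL : P.State →L[ℝ] (N → ℝ) := .comp (.fst ℝ _ _) (.snd ℝ _ _)
  let pML : P.State →L[ℝ] (N → ℝ) := .comp (.fst ℝ _ _) (.comp (.snd ℝ _ _) (.snd ℝ _ _))
  let pcL : P.State →L[ℝ] (N → ℝ) :=
    .comp (.fst ℝ _ _) (.comp (.snd ℝ _ _) (.comp (.snd ℝ _ _) (.snd ℝ _ _)))
  have hω' : ∀ j, Tendsto (fun t => P.ω (P.linearField (y t)) j) atTop (𝓝 0) := fun j =>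
    hstep ((ContinuousLinearMap.proj j : (N → ℝ) →L[ℝ] ℝ).comp ωL) (hω j)
  have hpM' : ∀ j, Tendsto (fun t => P.pM (P.linearField (y t)) j) atTop (𝓝 0) := fun j =>
    hstep ((ContinuousLinearMap.proj j : (N → ℝ) →L[ℝ] ℝ).comp pML) (hpM j)
  have hpc : ∀ j, Tendsto (fun t => P.pc (y t) j) atTop (𝓝 0) := by
    intro j
    -- The generation equation solved for the power command, which the dissipation does not see
    -- directly.
    have h := (((hpM' j).const_mul (P.γ j / P.κ j)).add ((hpM j).const_mul (P.κ j)⁻¹)).add (hω j)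
    simp only [mul_zero, add_zero] at h
    refine h.congr fun t => ?_
    have hγ := (P.γ_pos j).ne'
    have hκ := (P.κ_pos j).ne'
    simp only [linearField_apply, pM]
    field_simp
    ring
  have hpc' : ∀ j, Tendsto (fun t => P.pc (P.linearField (y t)) j) atTop (𝓝 0) := fun j =>
    hstep ((ContinuousLinearMap.proj j : (N → ℝ) →L[ℝ] ℝ).comp pcL) (hpc j)
  have hη' : ∀ e, Tendsto (fun t => P.η (P.linearField (y t)) e) atTop (𝓝 0) := fun e => by
    simpa [linearField_apply, η] using (hω e.1.1).sub (hω e.1.2)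
  have hψ' : ∀ e, Tendsto (fun t => P.ψ (P.linearField (y t)) e) atTop (𝓝 0) := fun e => by
    simpa [linearField_apply, ψ] using ((hpc e.1.1).sub (hpc e.1.2)).div_const (P.τlink e)
  exact (tendsto_pi_nhds.2 hη').prodMk_nhds ((tendsto_pi_nhds.2 hω').prodMk_nhds
    ((tendsto_pi_nhds.2 hpM').prodMk_nhds ((tendsto_pi_nhds.2 hpc').prodMk_nhds
      (tendsto_pi_nhds.2 hψ'))))

/-- For a constant switching state, every solution converges to the set of equilibria. -/
theorem tendsto_infEDist_equilibria {σ : Load L → Bool} {x : ℝ → P.State} {T : ℝ}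
    (hx : ∀ t, T < t → HasDerivAt x (P.vectorField σ (x t)) t) :
    Tendsto (fun s => Metric.infEDist (x s) {y | (y, σ) ∈ P.equilibria}) atTop (𝓝 0) := by
  obtain ⟨x₀, hx₀⟩ := P.exists_equilibrium σ
  have hlin : ∀ z, P.vectorField σ z = P.linearField (z - x₀) := fun z => by
    rw [← P.vectorField_sub σ, hx₀, sub_zero]
  have hF := P.tendsto_linearField (y := fun t => x t - x₀) (T := T) fun t ht => by
    rw [← hlin]
    exact (hx t ht).sub_const x₀
  obtain ⟨C, hC⟩ := exists_infDist_ker_le P.linearField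
  have hlim : Tendsto (fun t => ENNReal.ofReal (C * ‖P.linearField (x t - x₀)‖)) atTop (𝓝 0) := by
    have := ENNReal.tendsto_ofReal (hF.norm.const_mul C)
    simpa using this
  refine tendsto_of_tendsto_of_tendsto_of_le_of_le tendsto_const_nhds hlim
    (fun _ => zero_le) fun t => ?_
  obtain ⟨z, hz, hle⟩ := hC (x t - x₀)
  have hmem : z + x₀ ∈ {y | (y, σ) ∈ P.equilibria} := by
    change P.vectorField σ (z + x₀) = 0
    rw [hlin, add_sub_cancel_right, hz]
  refine (Metric.infEDist_le_edist_of_mem hmem).trans ?_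
  rw [edist_dist, dist_eq_norm]
  refine ENNReal.ofReal_le_ofReal ?_
  rwa [sub_add_eq_sub_sub_swap]

end

end PowerNetwork

end

/-- The extended distance to the empty set is infinite, so its convergence to zero also encodes that
equilibria exist for `σ'`. -/
theorem theorem2 {N : Type*} [Fintype N] [DecidableEq N] {L : N → Type*} [∀ j, Fintype (L j)]
    (P : PowerNetwork N L) :
    (∀ z ∈ P.equilibria, (∀ j, P.ω z.1 j = 0) ∧ ∃ a : ℝ, ∀ j, P.pc z.1 j = a) ∧
    ∀ (t : ℕ → ℝ), PowerNetwork.IsIterationTimes t →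
      ∀ (x : ℝ → P.State) (σ : ℝ → Load L → Bool), P.IsSolution t x σ →
        ∃ σ' : Load L → Bool,
          (∀ᶠ s in atTop, σ s = σ') ∧
          Tendsto (fun s => Metric.infEDist (x s) {y | (y, σ') ∈ P.equilibria}) atTop (𝓝 0) := by
  refine ⟨fun z hz => P.equilibrium_synchronized hz, fun t ht x σ hsol => ?_⟩
  obtain ⟨σ', hσ'⟩ := hsol.switching.exists_eventually_eq P ht
  refine ⟨σ', hσ', ?_⟩
  -- After a positive time `T` the switching state is constant, so the Caratheodory solution is a
  -- classical one.
  obtain ⟨T, hT⟩ := eventually_atTop.1 (hσ'.and (eventually_gt_atTop 0))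
  refine P.tendsto_infEDist_equilibria (T := T) (hasDerivAt_of_absolutelyContinuous_of_ae
    (P.continuous_vectorField σ') (hT T le_rfl).2 hsol.absolutelyContinuous ?_)
  filter_upwards [hsol.deriv] with s hs hTs
  rw [← (hT s hTs).1]
  exact hs (hT s hTs).2.le
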